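/- Let $\mathcal M$ be an $n$-dimensional smooth Riemannian manifold with Riemannian distance $d$, let $\mathbb Y,\mathbb Z$ be Euclidean spaces, let $f:\mathcal M\to\mathbb R$, $g_1:\mathcal M\to\mathbb Y$, $g_2:\mathcal M\to\mathbb Z$ be twice continuously differentiable, let $\theta:\mathbb Y\to(-\infty,+\infty]$ be a proper closed convex function and let $\mathcal Q\subset\mathbb Z$ be a nonempty closed convex set. Consider the problem $$\min\ f(x)+\theta(g_1(x))\quad\text{s.t.}\quad g_2(x)\in\mathcal Q,\ x\in\mathcal M .$$ Let $(x^*,y^*,z^*)\in\mathcal M\times\mathbb Y\times\mathbb Z$ be a KKT point of it, i.e. $\operatorname{grad}f(x^*)+Dg_1(x^*)^*y^*+Dg_2(x^*)^*z^*=0$, $y^*\in\partial\theta(g_1(x^*))$ and $z^*\in\mathcal N_{\mathcal Q}(g_2(x^*))$, where $Dg_i(x)^*:\ \cdot\to T_x\mathcal M$ is the adjoint of the differential with respect to the Riemannian metric, $\partial\theta$ is the convex subdifferential and $\mathcal N_{\mathcal Q}$ is the normal cone (empty outside $\mathcal Q$). Let $(\mathcal V,\varphi)$ be any smooth chart of $\mathcal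 M$ with $x^*\in\mathcal V$ (for example a Riemannian normal coordinate chart around $x^*$), and for $x\in\mathcal V$ let $G_{\varphi(x)}$ be the matrix of the Riemannian metric in the basis $D\varphi(x)^{-1}e_1,\dots,D\varphi(x)^{-1}e_n$ of $T_x\mathcal M$. For $q=(\hat a,b,c)\in\mathbb R^n\times\mathbb Y\times\mathbb Z$, the perturbed KKT system for $(x,y,z)\in\mathcal V\times\mathbb Y\times\mathbb Z$ is $$\left\{\begin{array}{l}(D\varphi(x))^{-1}G_{\varphi(x)}^{-1}\hat a=\operatorname{grad}f(x)+Dg_1(x)^*y+Dg_2(x)^*z,\\ y\in\partial\theta(g_1(x)+b),\\ z\in\mathcal N_{\mathcal Q}(g_2(x)+c),\end{array}\right.\tag{1}$$ and $M(x^*,0,0,0)\subset\mathbb Y\times\mathbb Z$ denotes the set of all $(y,z)$ such that $(x^*,y,z)$ solves (1) with $q=0$. With $L(x,y,z)=f(x)+\langle y,g_1(x)\rangle+\langle z,g_2(x)\rangle$, define the residual $$R(x,y,z)=\|\operatorname{grad}_xL(x,y,z)\|+\|g_1(x)-\operatorname{prox}_\theta(g_1(x)+y)\|+\|g_2(x)-\Pi_{\mathcal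 Q}(g_2(x)+z)\| ,$$ where $\operatorname{prox}_\theta(u)=\operatorname{argmin}_{v\in\mathbb Y}\{\theta(v)+\tfrac12\|u-v\|^2\}$ and $\Pi_{\mathcal Q}$ is the Euclidean projection onto $\mathcal Q$. Then the following assertions are equivalent: (i) There exist a neighborhood $\mathcal U$ of $x^*$, $\kappa>0$ and $\delta>0$ such that for all $q=(\hat a,b,c)$ with $\|q\|<\delta$, every solution $(x_q,y_q,z_q)$ of (1) with $x_q\in\mathcal U$ satisfies $$d(x_q,x^*)+\operatorname{dist}\big((y_q,z_q),M(x^*,0,0,0)\big)\le\kappa\|q\| .$$ (ii) There exist a neighborhood $\mathcal U$ of $x^*$, $\kappa>0$ and $\varepsilon>0$ such that for all $(x,y,z)\in\mathcal U\times\mathbb Y\times\mathbb Z$ with $R(x,y,z)<\varepsilon$, $$d(x,x^*)+\operatorname{dist}\big((y,z),M(x^*,0,0,0)\big)\le\kappa R(x,y,z) .$$ -/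

import Mathlib

open Set Filter Topology Asymptotics Manifold Bundle Matrix
open scoped ContDiff InnerProductSpace

noncomputable section

namespace ManifoldKKT

section Convex

variable {Y : Type*} [NormedAddCommGroup Y] [InnerProductSpace ℝ Y]

/-- The epigraph of an extended-real-valued function. -/
def epigraph (θ : Y → EReal) : Set (Y × ℝ) := {p | θ p.1 ≤ (p.2 : EReal)}

/-- `θ : Y → (-∞, +∞]` is proper, closed and convex. -/
structure IsProperClosedConvex (θ : Y → EReal) : Prop where
  ne_bot : ∀ u, θ u ≠ ⊥
  exists_ne_top : ∃ u, θ u ≠ ⊤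
  isClosed_epigraph : IsClosed (epigraph θ)
  convex_epigraph : Convex ℝ (epigraph θ)

/-- The subdifferential of a convex function; it is empty outside the effective domain. -/
def subdifferential (θ : Y → EReal) (u : Y) : Set Y :=
  {y | θ u ≠ ⊤ ∧ ∀ v, θ u + ((⟪y, v - u⟫_ℝ : ℝ) : EReal) ≤ θ v}

/-- `prox_θ(u)`: the minimizer of `v ↦ θ v + ½‖u - v‖²`, which exists and is unique when `θ` is
proper, closed and convex. -/
def prox (θ : Y → EReal) (u : Y) : Y :=
  Classical.epsilon fun p =>
    IsMinOn (fun v => θ v + ((1 / 2 * ‖u - v‖ ^ 2 : ℝ) : EReal)) univ p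

/-- The projection of `u` onto `D`: the point of `D` nearest to `u`, which exists and is unique
when `D` is nonempty, closed and convex. -/
def proj (D : Set Y) (u : Y) : Y :=
  Classical.epsilon fun p => p ∈ D ∧ IsMinOn (fun v => ‖u - v‖) D p

/-- The tangent cone: directions `d` with `dist(u + t_k d, D) = o(t_k)` for some positive
sequence `t_k → 0`. -/
def tangentCone (D : Set Y) (u : Y) : Set Y :=
  {d | ∃ t : ℕ → ℝ, (∀ k, 0 < t k) ∧ Tendsto t atTop (𝓝 0) ∧
    (fun k => Metric.infDist (u + t k • d) D) =o[atTop] t}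

/-- The normal cone at `u ∈ D`, the polar of the tangent cone; it is empty if `u ∉ D`. -/
def normalCone (D : Set Y) (u : Y) : Set Y :=
  {z | u ∈ D ∧ ∀ d ∈ tangentCone D u, ⟪z, d⟫_ℝ ≤ 0}

end Convex

section Manifold

variable {n : ℕ} {M : Type*} [TopologicalSpace M] [ChartedSpace (EuclideanSpace ℝ (Fin n)) M]
  [RiemannianBundle (fun x : M => TangentSpace (𝓡 n) x)]
  {Y : Type*} [NormedAddCommGroup Y] [InnerProductSpace ℝ Y] [FiniteDimensional ℝ Y]
  {Z : Type*} [NormedAddCommGroup Z] [InnerProductSpace ℝ Z] [FiniteDimensional ℝ Z]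

instance finiteDimensional_tangentSpace (x : M) :
    FiniteDimensional ℝ (TangentSpace (𝓡 n) x) :=
  inferInstanceAs (FiniteDimensional ℝ (EuclideanSpace ℝ (Fin n)))

instance completeSpace_tangentSpace (x : M) : CompleteSpace (TangentSpace (𝓡 n) x) :=
  FiniteDimensional.complete ℝ _

variable (n) in
/-- The differential `Dg(x) : T_x M → Y` of a map into a Euclidean space. -/
def differential (g : M → Y) (x : M) : TangentSpace (𝓡 n) x →L[ℝ] Y :=
  mfderiv (𝓡 n) 𝓘(ℝ, Y) g x

variable (n) in
/-- The Riemannian gradient: `⟪grad f(x), ξ⟫ = Df(x) ξ` for all `ξ ∈ T_x M`. -/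
def grad (f : M → ℝ) (x : M) : TangentSpace (𝓡 n) x :=
  (InnerProductSpace.toDual ℝ (TangentSpace (𝓡 n) x)).symm (differential n f x)

variable (n) in
/-- The adjoint `Dg(x)^* : Y → T_x M` with respect to the Riemannian metric. -/
def differentialAdjoint (g : M → Y) (x : M) : Y →L[ℝ] TangentSpace (𝓡 n) x :=
  ContinuousLinearMap.adjoint (differential n g x)

/-- `(Dφ(x))⁻¹ : ℝⁿ → T_x M` for a chart `φ` whose domain contains `x`. -/
def chartDerivInv (φ : OpenPartialHomeomorph M (EuclideanSpace ℝ (Fin n))) (x : M) :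
    EuclideanSpace ℝ (Fin n) →L[ℝ] TangentSpace (𝓡 n) x :=
  (differential n (φ : M → EuclideanSpace ℝ (Fin n)) x).inverse

/-- The matrix `G_{φ(x)}` of the Riemannian metric in the coordinate basis
`(Dφ(x))⁻¹ e_1, …, (Dφ(x))⁻¹ e_n` of `T_x M`. -/
def metricMatrix (φ : OpenPartialHomeomorph M (EuclideanSpace ℝ (Fin n))) (x : M) :
    Matrix (Fin n) (Fin n) ℝ :=
  Matrix.of fun i j =>
    ⟪chartDerivInv φ x (EuclideanSpace.single i 1),
      chartDerivInv φ x (EuclideanSpace.single j 1)⟫_ℝ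

/-- The Lagrangian `L(x, y, z) = f(x) + ⟪y, g₁(x)⟫ + ⟪z, g₂(x)⟫`. -/
def lagrangian (f : M → ℝ) (g₁ : M → Y) (g₂ : M → Z) (x : M) (y : Y) (z : Z) : ℝ :=
  f x + ⟪y, g₁ x⟫_ℝ + ⟪z, g₂ x⟫_ℝ

variable (n) in
/-- `(x, y, z)` is a KKT point of `min f(x) + θ(g₁(x))` subject to `g₂(x) ∈ Q`, `x ∈ M`. -/
def IsKKTPoint (f : M → ℝ) (g₁ : M → Y) (g₂ : M → Z) (θ : Y → EReal) (Q : Set Z)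
    (x : M) (y : Y) (z : Z) : Prop :=
  grad n f x + differentialAdjoint n g₁ x y + differentialAdjoint n g₂ x z = 0 ∧
    y ∈ subdifferential θ (g₁ x) ∧ z ∈ normalCone Q (g₂ x)

/-- `(x, y, z)`, with `x` in the domain of the chart `φ`, solves the KKT system of the perturbed
problem `min f(x) + θ(g₁(x) + b) - ⟪a, φ(x)⟫` subject to `g₂(x) + c ∈ Q`. -/
def IsPerturbedKKTPoint (φ : OpenPartialHomeomorph M (EuclideanSpace ℝ (Fin n)))
    (f : M → ℝ) (g₁ : M → Y) (g₂ : M → Z) (θ : Y → EReal) (Q : Set Z)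
    (a : EuclideanSpace ℝ (Fin n)) (b : Y) (c : Z) (x : M) (y : Y) (z : Z) : Prop :=
  x ∈ φ.source ∧
    chartDerivInv φ x (WithLp.toLp 2 ((metricMatrix φ x)⁻¹ *ᵥ a.ofLp)) =
      grad n f x + differentialAdjoint n g₁ x y + differentialAdjoint n g₂ x z ∧
    y ∈ subdifferential θ (g₁ x + b) ∧ z ∈ normalCone Q (g₂ x + c)

/-- The set `M(x, a, b, c)` of Lagrange multipliers at `x`, as a subset of the Euclidean space
`Y × Z`. -/
def multipliers (φ : OpenPartialHomeomorph M (EuclideanSpace ℝ (Fin n)))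
    (f : M → ℝ) (g₁ : M → Y) (g₂ : M → Z) (θ : Y → EReal) (Q : Set Z)
    (x : M) (a : EuclideanSpace ℝ (Fin n)) (b : Y) (c : Z) : Set (WithLp 2 (Y × Z)) :=
  {w | IsPerturbedKKTPoint φ f g₁ g₂ θ Q a b c x w.fst w.snd}

variable (n) in
/-- The KKT residual `R(x, y, z)`. -/
def kktResidual (f : M → ℝ) (g₁ : M → Y) (g₂ : M → Z) (θ : Y → EReal) (Q : Set Z)
    (x : M) (y : Y) (z : Z) : ℝ :=
  ‖grad n (fun x' => lagrangian f g₁ g₂ x' y z) x‖ + ‖g₁ x - prox θ (g₁ x + y)‖ +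
    ‖g₂ x - proj Q (g₂ x + z)‖

end Manifold

end ManifoldKKT

end

/-! Residuals and perturbations convert into each other with constants uniform near `xs`. The map `a
↦ (Dφ)⁻¹G⁻¹a` is the adjoint of `Dφ(x)`, so continuity of the metric bounds it and its inverse near
`xs`; perturbing by `a` amounts to perturbing by a tangent vector
(`exists_bound_chartDerivInv_metricMatrix_inv`). The maps `prox` and `proj` are resolvents of the
monotone operators `∂θ` and `N_Q`. (i) ⇒ (ii): put `b = prox θ (g₁ x + y) - g₁ x` and `c = proj Q
(g₂ x + z) - g₂ x`. By the resolvent identity, `(x, y - b, z - c)` solves the perturbed system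
exactly, with stationarity error `grad L - Dg₁*b - Dg₂*c`. All of this is `O(R)`, and moving the
multipliers back costs at most `R` (`exists_isPerturbedKKTPoint`). (ii) ⇒ (i): for a solution, `g₁ x
+ b` is the resolvent at `g₁ x + b + y`; nonexpansiveness bounds the residual at `g₁ x + y` by
`2‖b‖`, and similarly for `c` (`IsPerturbedKKTPoint.kktResidual_le`). Every bound depends on `x`
alone, so the multipliers need not be localized. -/

namespace ManifoldKKT

/-! ### Locally uniform bounds on differentials. -/

section LocalBounds

variable {n : ℕ} {M : Type*} [TopologicalSpace M] [ChartedSpace (EuclideanSpace ℝ (Fin n)) M]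

/-- The chain rule for a map read in a chart. -/
lemma differential_eq_fderiv_comp {F : Type*} [NormedAddCommGroup F] [InnerProductSpace ℝ F]
    {g : M → F} {ψ : OpenPartialHomeomorph M (EuclideanSpace ℝ (Fin n))} {x : M}
    (hx : x ∈ ψ.source) (hg : DifferentiableAt ℝ (g ∘ ψ.symm) (ψ x))
    (hψ : MDifferentiableAt (𝓡 n) (𝓡 n) ψ x) :
    differential n g x = (fderiv ℝ (g ∘ ψ.symm) (ψ x)).comp (differential n ψ x) := by
  have h1 : g =ᶠ[𝓝 x] (g ∘ ψ.symm) ∘ ψ := by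
    filter_upwards [ψ.open_source.mem_nhds hx] with y hy
    simp [ψ.left_inv hy]
  have h2 := mfderiv_comp x (I := 𝓡 n) (I' := 𝓡 n) (I'' := 𝓘(ℝ, F)) (g := g ∘ ψ.symm) (f := ψ)
    hg.mdifferentiableAt hψ
  rw [mfderiv_eq_fderiv] at h2
  exact h1.mfderiv_eq.trans h2

variable [IsManifold (𝓡 n) 1 M]

/-- Connects the chart to the bundle trivialization, where continuity of the metric gives locally
uniform norm bounds. -/
lemma differential_chartAt_eq (x₀ x : M) (hx : x ∈ (chartAt (EuclideanSpace ℝ (Fin n)) x₀).source)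
    (v : TangentSpace (𝓡 n) x) :
    differential n (chartAt (EuclideanSpace ℝ (Fin n)) x₀) x v =
      (trivializationAt (EuclideanSpace ℝ (Fin n)) (TangentSpace (𝓡 n)) x₀).continuousLinearMapAt
        ℝ x v := by
  rw [TangentBundle.continuousLinearMapAt_trivializationAt hx]
  rfl

variable [RiemannianBundle (fun x : M => TangentSpace (𝓡 n) x)]
  [IsContinuousRiemannianBundle (EuclideanSpace ℝ (Fin n)) (fun x : M => TangentSpace (𝓡 n) x)]
  {F : Type*} [NormedAddCommGroup F] [InnerProductSpace ℝ F]

/-- The differential of a preferred chart is bounded near the base point. -/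
lemma exists_norm_differential_chartAt_le (x₀ : M) :
    ∃ C > 0, ∀ᶠ x in 𝓝 x₀, ∀ v : TangentSpace (𝓡 n) x,
      ‖differential n (chartAt (EuclideanSpace ℝ (Fin n)) x₀) x v‖ ≤ C * ‖v‖ := by
  obtain ⟨C, hC, h⟩ := eventually_norm_trivializationAt_lt (EuclideanSpace ℝ (Fin n))
    (fun x : M => TangentSpace (𝓡 n) x) x₀
  refine ⟨C, hC, ?_⟩
  filter_upwards [h, chart_source_mem_nhds (EuclideanSpace ℝ (Fin n)) x₀] with x hx hxs v
  rw [differential_chartAt_eq x₀ x hxs v]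
  exact (ContinuousLinearMap.le_opNorm _ v).trans (by gcongr)

/-- The differential of a preferred chart is bounded below near the base point. -/
lemma exists_norm_le_differential_chartAt (x₀ : M) :
    ∃ C > 0, ∀ᶠ x in 𝓝 x₀, ∀ v : TangentSpace (𝓡 n) x,
      ‖v‖ ≤ C * ‖differential n (chartAt (EuclideanSpace ℝ (Fin n)) x₀) x v‖ := by
  obtain ⟨C, hC, h⟩ := eventually_norm_symmL_trivializationAt_lt (EuclideanSpace ℝ (Fin n))
    (fun x : M => TangentSpace (𝓡 n) x) x₀
  refine ⟨C, hC, ?_⟩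
  filter_upwards [h, chart_source_mem_nhds (EuclideanSpace ℝ (Fin n)) x₀] with x hx hxs v
  rw [differential_chartAt_eq x₀ x hxs v]
  have hv := (trivializationAt (EuclideanSpace ℝ (Fin n))
    (TangentSpace (𝓡 n)) x₀).symmL_continuousLinearMapAt (R := ℝ) (b := x) (by simpa using hxs) v
  conv_lhs => rw [← hv]
  exact (ContinuousLinearMap.le_opNorm _ _).trans (by gcongr)

/-- The operator norm of the differential of a `C¹` map is locally bounded. -/
lemma exists_norm_differential_le {g : M → F} {x₀ : M}
    (hg : ContMDiffAt (𝓡 n) 𝓘(ℝ, F) 1 g x₀) :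
    ∃ C > 0, ∀ᶠ x in 𝓝 x₀, ‖differential n g x‖ ≤ C := by
  set ψ := chartAt (EuclideanSpace ℝ (Fin n)) x₀ with hψ
  have hψs : x₀ ∈ ψ.source := mem_chart_source _ x₀
  obtain ⟨C, hC, h⟩ := exists_norm_differential_chartAt_le (n := n) x₀
  have hsymm : ContMDiffAt (𝓡 n) (𝓡 n) 1 ψ.symm (ψ x₀) :=
    contMDiffAt_symm_of_mem_maximalAtlas (IsManifold.chart_mem_maximalAtlas x₀)
      (ψ.map_source hψs)
  have hh : ContDiffAt ℝ 1 (g ∘ ψ.symm) (ψ x₀) := by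
    rw [← contMDiffAt_iff_contDiffAt]
    refine ContMDiffAt.comp (ψ x₀) (I' := 𝓡 n) ?_ hsymm
    rwa [ψ.left_inv hψs]
  have hcont : ContinuousAt (fun u => ‖fderiv ℝ (g ∘ ψ.symm) u‖) (ψ x₀) :=
    (hh.continuousAt_fderiv (by simp)).norm
  have hψc : ContinuousAt ψ x₀ := ψ.continuousAt hψs
  have hb := (hcont.comp hψc).eventually
    (gt_mem_nhds (show _ < ‖fderiv ℝ (g ∘ ψ.symm) (ψ x₀)‖ + 1 from lt_add_one _))
  have hd := hψc.eventually ((hh.eventually (by simp)))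
  refine ⟨(‖fderiv ℝ (g ∘ ψ.symm) (ψ x₀)‖ + 1) * C, by positivity, ?_⟩
  filter_upwards [h, hb, hd, ψ.open_source.mem_nhds hψs] with x hx hbx hdx hxs
  have hψd : MDifferentiableAt (𝓡 n) (𝓡 n) ψ x :=
    (mdifferentiable_chart x₀).mdifferentiableAt hxs
  have heq := differential_eq_fderiv_comp hxs (hdx.differentiableAt (by simp)) hψd
  refine ContinuousLinearMap.opNorm_le_bound _ (by positivity) fun v => ?_
  rw [heq, ContinuousLinearMap.comp_apply, mul_assoc]
  exact (ContinuousLinearMap.le_opNorm _ _).trans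
    (mul_le_mul hbx.le (hx v) (norm_nonneg _) (by positivity))

/-- The differential of a chart is bounded below near every point of its domain. -/
lemma exists_norm_le_differential_chart
    {φ : OpenPartialHomeomorph M (EuclideanSpace ℝ (Fin n))}
    (hφ : φ ∈ IsManifold.maximalAtlas (𝓡 n) 1 M) {x₀ : M} (hx₀ : x₀ ∈ φ.source) :
    ∃ C > 0, ∀ᶠ x in 𝓝 x₀, ∀ v : TangentSpace (𝓡 n) x,
      ‖v‖ ≤ C * ‖differential n φ x v‖ := by
  set ψ := chartAt (EuclideanSpace ℝ (Fin n)) x₀ with hψ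
  have hψs : x₀ ∈ ψ.source := mem_chart_source _ x₀
  obtain ⟨C, hC, h⟩ := exists_norm_le_differential_chartAt (n := n) x₀
  have hsymm : ContMDiffAt (𝓡 n) (𝓡 n) 1 φ.symm (φ x₀) :=
    contMDiffAt_symm_of_mem_maximalAtlas hφ (φ.map_source hx₀)
  have hψat : ContMDiffAt (𝓡 n) (𝓡 n) 1 ψ x₀ :=
    contMDiffAt_of_mem_maximalAtlas (IsManifold.chart_mem_maximalAtlas x₀) hψs
  -- Through `Dψ = D(ψ ∘ φ⁻¹) ∘ Dφ`, the lower bound for the preferred chart passes to `φ`.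
  have hh : ContDiffAt ℝ 1 (ψ ∘ φ.symm) (φ x₀) := by
    rw [← contMDiffAt_iff_contDiffAt]
    refine ContMDiffAt.comp (φ x₀) (I' := 𝓡 n) ?_ hsymm
    rwa [φ.left_inv hx₀]
  have hcont : ContinuousAt (fun u => ‖fderiv ℝ (ψ ∘ φ.symm) u‖) (φ x₀) :=
    (hh.continuousAt_fderiv (by simp)).norm
  have hφc : ContinuousAt φ x₀ := φ.continuousAt hx₀
  have hb := (hcont.comp hφc).eventually
    (gt_mem_nhds (show _ < ‖fderiv ℝ (ψ ∘ φ.symm) (φ x₀)‖ + 1 from lt_add_one _))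
  have hd := hφc.eventually ((hh.eventually (by simp)))
  refine ⟨C * (‖fderiv ℝ (ψ ∘ φ.symm) (φ x₀)‖ + 1), by positivity, ?_⟩
  filter_upwards [h, hb, hd, φ.open_source.mem_nhds hx₀] with x hx hbx hdx hxs v
  have hφd : MDifferentiableAt (𝓡 n) (𝓡 n) φ x :=
    (contMDiffAt_of_mem_maximalAtlas hφ hxs).mdifferentiableAt (by simp)
  have heq := differential_eq_fderiv_comp hxs (hdx.differentiableAt (by simp)) hφd
  refine (hx v).trans ?_
  rw [heq, ContinuousLinearMap.comp_apply, mul_assoc]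
  gcongr
  exact (ContinuousLinearMap.le_opNorm _ _).trans (by gcongr; exact hbx.le)

end LocalBounds

/-! ### The coordinate form of tangent vectors. -/

section ChartDerivative

variable {n : ℕ} {M : Type*} [TopologicalSpace M] [ChartedSpace (EuclideanSpace ℝ (Fin n)) M]
  {φ : OpenPartialHomeomorph M (EuclideanSpace ℝ (Fin n))} {x : M}

/-- The differential of an atlas chart is an equivalence, so `ContinuousLinearMap.inverse` is a true
inverse here and not its default value. -/
lemma chartDerivInv_apply_differential (hφ : φ ∈ IsManifold.maximalAtlas (𝓡 n) 1 M)
    (hx : x ∈ φ.source) (v : TangentSpace (𝓡 n) x) :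
    chartDerivInv φ x (differential n φ x v) = v := by
  have he : φ.MDifferentiable (𝓡 n) (𝓡 n) :=
    ⟨(contMDiffOn_of_mem_maximalAtlas hφ).mdifferentiableOn (by simp),
      (contMDiffOn_symm_of_mem_maximalAtlas hφ).mdifferentiableOn (by simp)⟩
  let e : TangentSpace (𝓡 n) x ≃L[ℝ] EuclideanSpace ℝ (Fin n) := he.mfderiv hx
  have h1 : differential n φ x = (e : TangentSpace (𝓡 n) x →L[ℝ] EuclideanSpace ℝ (Fin n)) := rfl
  rw [chartDerivInv, h1, ContinuousLinearMap.inverse_equiv]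
  exact e.symm_apply_apply v

lemma differential_apply_chartDerivInv (hφ : φ ∈ IsManifold.maximalAtlas (𝓡 n) 1 M)
    (hx : x ∈ φ.source) (w : EuclideanSpace ℝ (Fin n)) :
    differential n φ x (chartDerivInv φ x w) = w := by
  have he : φ.MDifferentiable (𝓡 n) (𝓡 n) :=
    ⟨(contMDiffOn_of_mem_maximalAtlas hφ).mdifferentiableOn (by simp),
      (contMDiffOn_symm_of_mem_maximalAtlas hφ).mdifferentiableOn (by simp)⟩
  let e : TangentSpace (𝓡 n) x ≃L[ℝ] EuclideanSpace ℝ (Fin n) := he.mfderiv hx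
  have h1 : differential n φ x = (e : TangentSpace (𝓡 n) x →L[ℝ] EuclideanSpace ℝ (Fin n)) := rfl
  rw [chartDerivInv, h1, ContinuousLinearMap.inverse_equiv]
  exact e.apply_symm_apply w

variable [RiemannianBundle (fun x : M => TangentSpace (𝓡 n) x)]

lemma inner_chartDerivInv (φ : OpenPartialHomeomorph M (EuclideanSpace ℝ (Fin n))) (x : M)
    (u w : EuclideanSpace ℝ (Fin n)) :
    ⟪chartDerivInv φ x u, chartDerivInv φ x w⟫_ℝ =
      ⟪WithLp.toLp 2 (metricMatrix φ x *ᵥ u.ofLp), w⟫_ℝ := by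
  have hsum (u : EuclideanSpace ℝ (Fin n)) : chartDerivInv φ x u =
      ∑ i, u i • chartDerivInv φ x (EuclideanSpace.single i 1) := by
    conv_lhs => rw [← (EuclideanSpace.basisFun (Fin n) ℝ).sum_repr u]
    simp [map_sum]
  have hsymm (i j : Fin n) : metricMatrix φ x i j = metricMatrix φ x j i := by
    simp [metricMatrix, real_inner_comm]
  rw [hsum u, hsum w, PiLp.inner_apply]
  simp only [sum_inner, inner_sum, inner_smul_left, inner_smul_right, Matrix.mulVec, dotProduct]
  refine Finset.sum_congr rfl fun j _ => ?_
  simp only [RCLike.inner_apply, conj_trivial, Finset.mul_sum]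
  refine Finset.sum_congr rfl fun i _ => ?_
  rw [hsymm j i]
  simp only [metricMatrix, Matrix.of_apply]
  ring

lemma isUnit_metricMatrix (hφ : φ ∈ IsManifold.maximalAtlas (𝓡 n) 1 M) (hx : x ∈ φ.source) :
    IsUnit (metricMatrix φ x) := by
  rw [← Matrix.mulVec_injective_iff_isUnit, ← Matrix.coe_mulVecLin, ← LinearMap.ker_eq_bot,
    LinearMap.ker_eq_bot']
  intro u hu
  rw [Matrix.mulVecLin_apply] at hu
  have h := inner_chartDerivInv φ x (WithLp.toLp 2 u) (WithLp.toLp 2 u)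
  rw [hu] at h
  -- `Gu = 0` forces `‖(Dφ)⁻¹u‖² = ⟪Gu, u⟫ = 0`.
  have h0 : chartDerivInv φ x (WithLp.toLp 2 u) = 0 := by
    rw [← inner_self_eq_zero (𝕜 := ℝ), h]; simp
  have h1 := differential_apply_chartDerivInv hφ hx (WithLp.toLp 2 u)
  rw [h0, map_zero] at h1
  exact congrArg WithLp.ofLp h1.symm

/-- `(Dφ(x))⁻¹ G⁻¹` is the adjoint of `Dφ(x)`. -/
lemma chartDerivInv_metricMatrix_inv (hφ : φ ∈ IsManifold.maximalAtlas (𝓡 n) 1 M)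
    (hx : x ∈ φ.source) (a : EuclideanSpace ℝ (Fin n)) :
    chartDerivInv φ x (WithLp.toLp 2 ((metricMatrix φ x)⁻¹ *ᵥ a.ofLp)) =
      ContinuousLinearMap.adjoint (differential n φ x) a := by
  refine ext_inner_right ℝ fun v => ?_
  rw [ContinuousLinearMap.adjoint_inner_left]
  conv_lhs => rw [← chartDerivInv_apply_differential hφ hx v, inner_chartDerivInv]
  rw [Matrix.mulVec_mulVec, Matrix.mul_nonsing_inv _
    ((Matrix.isUnit_iff_isUnit_det _).1 (isUnit_metricMatrix hφ hx)), Matrix.one_mulVec]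

/-- Near a point of its domain, the coordinate representation `a ↦ (Dφ(x))⁻¹ G⁻¹ a` of tangent
vectors and its inverse are uniformly bounded. -/
lemma exists_bound_chartDerivInv_metricMatrix_inv
    [IsManifold (𝓡 n) 1 M]
    [IsContinuousRiemannianBundle (EuclideanSpace ℝ (Fin n)) (fun x : M => TangentSpace (𝓡 n) x)]
    (hφ : φ ∈ IsManifold.maximalAtlas (𝓡 n) 1 M) (hx : x ∈ φ.source) :
    ∃ C > 0, ∀ᶠ x' in 𝓝 x,
      (∀ a : EuclideanSpace ℝ (Fin n),
        ‖chartDerivInv φ x' (WithLp.toLp 2 ((metricMatrix φ x')⁻¹ *ᵥ a.ofLp))‖ ≤ C * ‖a‖) ∧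
      ∀ η : TangentSpace (𝓡 n) x', ∃ a : EuclideanSpace ℝ (Fin n),
        chartDerivInv φ x' (WithLp.toLp 2 ((metricMatrix φ x')⁻¹ *ᵥ a.ofLp)) = η ∧
          ‖a‖ ≤ C * ‖η‖ := by
  obtain ⟨C₁, hC₁, h₁⟩ := exists_norm_differential_le (contMDiffAt_of_mem_maximalAtlas hφ hx)
  obtain ⟨C₂, hC₂, h₂⟩ := exists_norm_le_differential_chart hφ hx
  refine ⟨max C₁ C₂, lt_max_of_lt_left hC₁, ?_⟩
  filter_upwards [h₁, h₂, φ.open_source.mem_nhds hx] with y hy₁ hy₂ hys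
  -- As the map is `(Dφ)*`, the preimage of `η` is `((Dφ)⁻¹)* η`.
  refine ⟨fun a => ?_, fun η => ⟨ContinuousLinearMap.adjoint (chartDerivInv φ y) η, ?_, ?_⟩⟩
  · rw [chartDerivInv_metricMatrix_inv hφ hys]
    refine (ContinuousLinearMap.le_opNorm _ _).trans ?_
    rw [LinearIsometryEquiv.norm_map]
    gcongr
    exact hy₁.trans (le_max_left _ _)
  · rw [chartDerivInv_metricMatrix_inv hφ hys]
    refine ext_inner_right ℝ fun v => ?_
    rw [ContinuousLinearMap.adjoint_inner_left, ContinuousLinearMap.adjoint_inner_left,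
      chartDerivInv_apply_differential hφ hys]
  · refine (ContinuousLinearMap.le_opNorm _ _).trans ?_
    rw [LinearIsometryEquiv.norm_map]
    gcongr
    refine (ContinuousLinearMap.opNorm_le_bound _ hC₂.le fun w => ?_).trans (le_max_right _ _)
    simpa only [differential_apply_chartDerivInv hφ hys] using hy₂ (chartDerivInv φ y w)

end ChartDerivative

/-! ### Proximal map and projection as resolvents. -/

section ProxProj

variable {Y : Type*} [NormedAddCommGroup Y] [InnerProductSpace ℝ Y] {θ : Y → EReal} {Q : Set Y}

/-- Nonexpansiveness of a resolvent: pair `(p - p') + (y - y')` with `p - p'` and apply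
Cauchy–Schwarz. -/
lemma norm_sub_le_of_monotone {p p' y y' : Y} (h : 0 ≤ ⟪y - y', p - p'⟫_ℝ) :
    ‖p - p'‖ ≤ ‖(p + y) - (p' + y')‖ := by
  have h1 : ‖p - p'‖ * ‖p - p'‖ ≤ ‖(p + y) - (p' + y')‖ * ‖p - p'‖ := by
    rw [← real_inner_self_eq_norm_mul_norm]
    refine le_trans ?_ (real_inner_le_norm _ _)
    have : (p + y) - (p' + y') = (p - p') + (y - y') := by abel
    rw [this, inner_add_left]
    linarith
  rcases (norm_nonneg (p - p')).eq_or_lt with h0 | h0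
  · rw [← h0]; positivity
  · exact le_of_mul_le_mul_right h1 h0

/-- The residual of a nonexpansive resolvent under a shift of its argument. -/
lemma norm_sub_le_two_mul_of_monotone {u b p y y' : Y} (hp : p + y' = u + y)
    (h : 0 ≤ ⟪y' - y, p - (u + b)⟫_ℝ) : ‖u - p‖ ≤ 2 * ‖b‖ := by
  -- The resolvent values `p` and `u + b` belong to arguments `u + y` and `u + b + y`, which differ
  -- by `b`.
  have h1 := norm_sub_le_of_monotone h
  have h2 : (p + y') - (u + b + y) = -b := by rw [hp]; abel
  rw [h2, norm_neg] at h1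
  calc ‖u - p‖ = ‖-(p - (u + b)) - b‖ := by congr 1; abel
    _ ≤ ‖-(p - (u + b))‖ + ‖b‖ := norm_sub_le _ _
    _ ≤ 2 * ‖b‖ := by rw [norm_neg]; linarith

/-- For convex `Q`, segments make every `v - u` tangent; conversely, `o(t)` approximation of `u +
td` by `Q` carries the inequality to tangent directions. -/
lemma mem_normalCone_iff (hQ : Convex ℝ Q) {u z : Y} :
    z ∈ normalCone Q u ↔ u ∈ Q ∧ ∀ v ∈ Q, ⟪z, v - u⟫_ℝ ≤ 0 := by
  refine and_congr_right fun hu => ⟨fun h v hv => h _ ?_, fun h d hd => ?_⟩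
  · refine ⟨fun k => 1 / ((k : ℝ) + 1), fun k => by positivity,
      tendsto_one_div_add_atTop_nhds_zero_nat, ?_⟩
    have h0 : (fun k : ℕ => Metric.infDist (u + (1 / ((k : ℝ) + 1)) • (v - u)) Q) =
        fun _ => 0 := by
      funext k
      refine Metric.infDist_zero_of_mem (hQ.add_smul_sub_mem hu hv ⟨by positivity, ?_⟩)
      rw [div_le_one (by positivity)]
      have : (0 : ℝ) ≤ k := by positivity
      linarith
    rw [h0]
    exact isLittleO_zero _ _
  · obtain ⟨t, ht, -, ho⟩ := hd
    have key (k : ℕ) : ⟪z, d⟫_ℝ ≤ ‖z‖ * (Metric.infDist (u + t k • d) Q / t k) := by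
      rw [← mul_div_assoc, le_div_iff₀ (ht k)]
      have hle : ∀ v ∈ Q, ⟪z, d⟫_ℝ * t k ≤ ‖z‖ * dist (u + t k • d) v := fun v hv => by
        have h1 : ⟪z, d⟫_ℝ * t k = ⟪z, u + t k • d - v⟫_ℝ + ⟪z, v - u⟫_ℝ := by
          rw [← inner_add_right, mul_comm, ← inner_smul_right]
          congr 1; abel
        rw [h1, dist_eq_norm]
        linarith [h v hv, real_inner_le_norm z (u + t k • d - v)]
      rcases (norm_nonneg z).eq_or_lt with hz | hz
      · rw [← hz] at hle ⊢
        simpa using hle u hu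
      · rw [← div_le_iff₀' hz]
        exact (Metric.le_infDist ⟨u, hu⟩).2 fun v hv => (div_le_iff₀' hz).2 (hle v hv)
    have hlim := (ho.tendsto_div_nhds_zero).const_mul ‖z‖
    rw [mul_zero] at hlim
    exact ge_of_tendsto' hlim key

lemma proj_spec [CompleteSpace Y] (hne : Q.Nonempty) (hcl : IsClosed Q) (hQ : Convex ℝ Q)
    (u : Y) : u - proj Q u ∈ normalCone Q (proj Q u) := by
  have hex : ∃ p, p ∈ Q ∧ IsMinOn (fun v => ‖u - v‖) Q p := by
    obtain ⟨p, hp, h⟩ := exists_norm_eq_iInf_of_complete_convex hne hcl.isComplete hQ u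
    refine ⟨p, hp, fun v hv => ?_⟩
    simp only [mem_ofPred_eq, h]
    exact ciInf_le ⟨0, by rintro _ ⟨w, rfl⟩; positivity⟩ (⟨v, hv⟩ : Q)
  obtain ⟨hp, hmin⟩ : proj Q u ∈ Q ∧ IsMinOn (fun v => ‖u - v‖) Q (proj Q u) :=
    Classical.epsilon_spec hex
  rw [mem_normalCone_iff hQ]
  refine ⟨hp, (norm_eq_iInf_iff_real_inner_le_zero hQ hp).1 ?_⟩
  have : Nonempty Q := ⟨⟨_, hp⟩⟩
  refine le_antisymm (le_ciInf fun w => hmin w.2) ?_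
  exact ciInf_le ⟨0, by rintro _ ⟨w, rfl⟩; positivity⟩ (⟨_, hp⟩ : Q)

lemma normalCone_monotone (hQ : Convex ℝ Q) {p p' z z' : Y} (h : z ∈ normalCone Q p)
    (h' : z' ∈ normalCone Q p') : 0 ≤ ⟪z - z', p - p'⟫_ℝ := by
  rw [mem_normalCone_iff hQ] at h h'
  have h1 := h.2 _ h'.1
  have h2 := h'.2 _ h.1
  rw [← neg_sub p p', inner_neg_right] at h1
  rw [inner_sub_left]
  linarith

/-- On the effective domain, the subgradient inequality is an inequality on the epigraph. -/
lemma mem_subdifferential_iff (hθ : ∀ u, θ u ≠ ⊥) {u y : Y} :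
    y ∈ subdifferential θ u ↔ θ u ≠ ⊤ ∧
      ∀ (v : Y) (s : ℝ), θ v ≤ s → (θ u).toReal + ⟪y, v - u⟫_ℝ ≤ s := by
  refine and_congr_right fun hu => ?_
  rw [← EReal.coe_toReal hu (hθ u), EReal.toReal_coe]
  refine ⟨fun h v s hv => by exact_mod_cast (h v).trans hv, fun h v => ?_⟩
  by_cases hv : θ v = ⊤
  · simp [hv]
  · rw [← EReal.coe_toReal hv (hθ v)]
    exact_mod_cast h v _ (EReal.coe_toReal hv (hθ v)).ge

lemma subdifferential_monotone (hθ : ∀ u, θ u ≠ ⊥) {p p' y y' : Y}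
    (h : y ∈ subdifferential θ p) (h' : y' ∈ subdifferential θ p') :
    0 ≤ ⟪y - y', p - p'⟫_ℝ := by
  rw [mem_subdifferential_iff hθ] at h h'
  have h1 := h.2 _ _ (EReal.coe_toReal h'.1 (hθ p')).ge
  have h2 := h'.2 _ _ (EReal.coe_toReal h.1 (hθ p)).ge
  rw [← neg_sub p p', inner_neg_right] at h1
  rw [inner_sub_left]
  linarith

/-- A closed function with a subgradient has a proximal point at every `u`. -/
lemma exists_isMinOn_prox [FiniteDimensional ℝ Y] (hθ : IsProperClosedConvex θ) {u₀ y₀ : Y}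
    (h₀ : y₀ ∈ subdifferential θ u₀) (u : Y) :
    ∃ p, IsMinOn (fun v => θ v + ((1 / 2 * ‖u - v‖ ^ 2 : ℝ) : EReal)) univ p := by
  rw [mem_subdifferential_iff hθ.ne_bot] at h₀
  obtain ⟨h₀t, h₀⟩ := h₀
  set r₀ := (θ u₀).toReal with hr₀
  have hE₀ : θ u₀ ≤ r₀ := (EReal.coe_toReal h₀t (hθ.ne_bot u₀)).ge
  let F : Y × ℝ → ℝ := fun q => q.2 + 1 / 2 * ‖u - q.1‖ ^ 2
  have hF : Continuous F := by fun_prop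
  let K : Set (Y × ℝ) := epigraph θ ∩ {q | F q ≤ F (u₀, r₀)}
  have hKc : IsClosed K := hθ.isClosed_epigraph.inter (isClosed_le hF continuous_const)
  set c := 1 / 2 * ‖u - u₀‖ ^ 2 + ‖y₀‖ * ‖u - u₀‖ with hc
  have hc0 : 0 ≤ c := by positivity
  -- The subgradient at `u₀` is an affine minorant, giving `½r² ≤ c + ‖y₀‖r` for `r = ‖u - v‖`; this
  -- fails once `r > N`.
  set N := 2 * ‖y₀‖ + 2 * c + 2 with hN
  have hsub : K ⊆ Metric.closedBall u N ×ˢ Icc (r₀ - ‖y₀‖ * (N + ‖u - u₀‖)) (F (u₀, r₀)) := by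
    rintro ⟨v, s⟩ ⟨hv, hs⟩
    have h1 := h₀ v s hv
    have hs' : s + 1 / 2 * ‖u - v‖ ^ 2 ≤ r₀ + 1 / 2 * ‖u - u₀‖ ^ 2 := hs
    have h2 : -(‖y₀‖ * ‖v - u₀‖) ≤ ⟪y₀, v - u₀⟫_ℝ :=
      (abs_le.1 (abs_real_inner_le_norm y₀ (v - u₀))).1
    have h3 : ‖v - u₀‖ ≤ ‖u - v‖ + ‖u - u₀‖ := by
      rw [norm_sub_rev u v]
      exact norm_sub_le_norm_sub_add_norm_sub v u u₀
    have h4 : ‖y₀‖ * ‖v - u₀‖ ≤ ‖y₀‖ * (‖u - v‖ + ‖u - u₀‖) := by gcongr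
    have hball : ‖u - v‖ ≤ N := by
      by_contra! hlt
      nlinarith [norm_nonneg y₀, norm_nonneg (u - v)]
    refine ⟨by rwa [mem_closedBall_iff_norm, norm_sub_rev], ?_, ?_⟩
    · have : ‖y₀‖ * (‖u - v‖ + ‖u - u₀‖) ≤ ‖y₀‖ * (N + ‖u - u₀‖) := by gcongr
      change _ ≤ s
      linarith
    · change s ≤ r₀ + 1 / 2 * ‖u - u₀‖ ^ 2
      nlinarith [sq_nonneg ‖u - v‖]
  have hK : IsCompact K :=
    ((isCompact_closedBall u N).prod isCompact_Icc).of_isClosed_subset hKc hsub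
  obtain ⟨⟨p, t⟩, ⟨hpE, hpF⟩, hmin⟩ := hK.exists_isMinOn
    ⟨(u₀, r₀), hE₀, le_refl (F (u₀, r₀))⟩ hF.continuousOn
  refine ⟨p, fun v _ => ?_⟩
  simp only [mem_ofPred_eq]
  by_cases hv : θ v = ⊤
  · rw [hv, EReal.top_add_coe]
    exact le_top
  have hvE : θ v ≤ ((θ v).toReal : EReal) := (EReal.coe_toReal hv (hθ.ne_bot v)).ge
  have hle : F (p, t) ≤ F (v, (θ v).toReal) := by
    by_cases hvK : F (v, (θ v).toReal) ≤ F (u₀, r₀)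
    · exact hmin ⟨hvE, hvK⟩
    · exact le_trans hpF (not_le.1 hvK).le
  calc θ p + ((1 / 2 * ‖u - p‖ ^ 2 : ℝ) : EReal)
      ≤ (t : EReal) + ((1 / 2 * ‖u - p‖ ^ 2 : ℝ) : EReal) := by gcongr; exact hpE
    _ ≤ ((θ v).toReal : EReal) + ((1 / 2 * ‖u - v‖ ^ 2 : ℝ) : EReal) := by exact_mod_cast hle
    _ = _ := by rw [EReal.coe_toReal hv (hθ.ne_bot v)]

/-- The optimality condition of the proximal problem. -/
lemma sub_prox_mem_subdifferential [FiniteDimensional ℝ Y] (hθ : IsProperClosedConvex θ)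
    {u₀ y₀ : Y} (h₀ : y₀ ∈ subdifferential θ u₀) (u : Y) :
    u - prox θ u ∈ subdifferential θ (prox θ u) := by
  have hmin : IsMinOn (fun v => θ v + ((1 / 2 * ‖u - v‖ ^ 2 : ℝ) : EReal)) univ (prox θ u) :=
    Classical.epsilon_spec (exists_isMinOn_prox hθ h₀ u)
  set p := prox θ u
  have hle (v : Y) (s : ℝ) (hv : θ v ≤ s) :
      θ p + ((1 / 2 * ‖u - p‖ ^ 2 : ℝ) : EReal) ≤ ((s + 1 / 2 * ‖u - v‖ ^ 2 : ℝ) : EReal) := by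
    have h : θ p + ((1 / 2 * ‖u - p‖ ^ 2 : ℝ) : EReal) ≤
        θ v + ((1 / 2 * ‖u - v‖ ^ 2 : ℝ) : EReal) := hmin (mem_univ v)
    rw [EReal.coe_add]
    exact h.trans (by gcongr)
  have hpt : θ p ≠ ⊤ := by
    intro h
    have := hle u₀ _ (EReal.coe_toReal h₀.1 (hθ.ne_bot u₀)).ge
    rw [h, EReal.top_add_coe, top_le_iff] at this
    exact EReal.coe_ne_top _ this
  rw [mem_subdifferential_iff hθ.ne_bot]
  refine ⟨hpt, fun v s hv => ?_⟩
  have hpr := EReal.coe_toReal hpt (hθ.ne_bot p)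
  set r := (θ p).toReal
  -- Compare `p` with `p + l(v - p)`, using convexity of the epigraph, and divide by `l`.
  have hlam (l : ℝ) (hl0 : 0 < l) (hl1 : l ≤ 1) :
      r + ⟪u - p, v - p⟫_ℝ ≤ s + l / 2 * ‖v - p‖ ^ 2 := by
    have hE : (p, r) + l • ((v, s) - (p, r)) ∈ epigraph θ :=
      hθ.convex_epigraph.add_smul_sub_mem hpr.ge hv ⟨hl0.le, hl1⟩
    have h1 := hle (p + l • (v - p)) (r + l * (s - r)) hE
    rw [← hpr] at h1
    have h2 : r + 1 / 2 * ‖u - p‖ ^ 2 ≤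
        r + l * (s - r) + 1 / 2 * ‖u - (p + l • (v - p))‖ ^ 2 := by exact_mod_cast h1
    rw [← sub_sub, norm_sub_sq_real (u - p), inner_smul_right, norm_smul, mul_pow,
      Real.norm_eq_abs, sq_abs] at h2
    refine le_of_mul_le_mul_left ?_ hl0
    nlinarith
  by_contra! hlt
  set D := r + ⟪u - p, v - p⟫_ℝ - s with hD
  have hDpos : 0 < D := by linarith
  set n := ‖v - p‖ ^ 2 with hn
  have hn0 : 0 ≤ n := by positivity
  -- Replaces the limit `l → 0`: this `l` has `l(n + 1) ≤ D`, against `D ≤ ln/2`.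
  have h1 := hlam (min 1 (D / (n + 1))) (by positivity) (min_le_left _ _)
  have h2 : min 1 (D / (n + 1)) * (n + 1) ≤ D := by
    rw [← le_div_iff₀ (by positivity)]
    exact min_le_right _ _
  have h3 : 0 < min 1 (D / (n + 1)) := by positivity
  nlinarith

end ProxProj

/-! ### Passing between residuals and perturbations. -/

section Residual

lemma norm_toLp_prod_le {E F : Type*} [NormedAddCommGroup E] [NormedAddCommGroup F] (a : E)
    (b : F) : ‖WithLp.toLp 2 (a, b)‖ ≤ ‖a‖ + ‖b‖ := by
  rw [WithLp.prod_norm_eq_of_L2]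
  refine Real.sqrt_le_iff.2 ⟨by positivity, ?_⟩
  change ‖a‖ ^ 2 + ‖b‖ ^ 2 ≤ (‖a‖ + ‖b‖) ^ 2
  nlinarith [norm_nonneg a, norm_nonneg b]

variable {n : ℕ} {M : Type*} [TopologicalSpace M] [ChartedSpace (EuclideanSpace ℝ (Fin n)) M]
  [RiemannianBundle (fun x : M => TangentSpace (𝓡 n) x)]
  {Y : Type*} [NormedAddCommGroup Y] [InnerProductSpace ℝ Y] [FiniteDimensional ℝ Y]
  {Z : Type*} [NormedAddCommGroup Z] [InnerProductSpace ℝ Z] [FiniteDimensional ℝ Z]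
  {f : M → ℝ} {g₁ : M → Y} {g₂ : M → Z} {θ : Y → EReal} {Q : Set Z}
  {φ : OpenPartialHomeomorph M (EuclideanSpace ℝ (Fin n))} {x : M}

lemma grad_lagrangian (hf : MDifferentiableAt (𝓡 n) 𝓘(ℝ, ℝ) f x)
    (hg₁ : MDifferentiableAt (𝓡 n) 𝓘(ℝ, Y) g₁ x) (hg₂ : MDifferentiableAt (𝓡 n) 𝓘(ℝ, Z) g₂ x)
    (y : Y) (z : Z) :
    grad n (fun x' => lagrangian f g₁ g₂ x' y z) x =
      grad n f x + differentialAdjoint n g₁ x y + differentialAdjoint n g₂ x z := by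
  have h1 : HasMFDerivAt (𝓡 n) 𝓘(ℝ, ℝ) (fun x' => ⟪y, g₁ x'⟫_ℝ) x
      ((innerSL ℝ y).comp (differential n g₁ x)) :=
    (innerSL ℝ y).hasMFDerivAt.comp x hg₁.hasMFDerivAt
  have h2 : HasMFDerivAt (𝓡 n) 𝓘(ℝ, ℝ) (fun x' => ⟪z, g₂ x'⟫_ℝ) x
      ((innerSL ℝ z).comp (differential n g₂ x)) :=
    (innerSL ℝ z).hasMFDerivAt.comp x hg₂.hasMFDerivAt
  have h3 : differential n (fun x' => lagrangian f g₁ g₂ x' y z) x =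
      differential n f x + (innerSL ℝ y).comp (differential n g₁ x) +
        (innerSL ℝ z).comp (differential n g₂ x) :=
    ((hf.hasMFDerivAt.add h1).add h2).mfderiv
  refine ext_inner_right ℝ fun v => ?_
  simp only [grad, differentialAdjoint, inner_add_left, ContinuousLinearMap.adjoint_inner_left,
    InnerProductSpace.toDual_symm_apply, h3]
  rfl

/-- The residual of a solution of the perturbed system is controlled by the perturbation. -/
lemma IsPerturbedKKTPoint.kktResidual_le (hf : MDifferentiableAt (𝓡 n) 𝓘(ℝ, ℝ) f x)
    (hg₁ : MDifferentiableAt (𝓡 n) 𝓘(ℝ, Y) g₁ x) (hg₂ : MDifferentiableAt (𝓡 n) 𝓘(ℝ, Z) g₂ x)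
    (hθ : IsProperClosedConvex θ) (hQ_closed : IsClosed Q) (hQ : Convex ℝ Q) {C : ℝ}
    (hC : ∀ a : EuclideanSpace ℝ (Fin n),
      ‖chartDerivInv φ x (WithLp.toLp 2 ((metricMatrix φ x)⁻¹ *ᵥ a.ofLp))‖ ≤ C * ‖a‖)
    {a : EuclideanSpace ℝ (Fin n)} {b : Y} {c : Z} {y : Y} {z : Z}
    (h : IsPerturbedKKTPoint φ f g₁ g₂ θ Q a b c x y z) :
    kktResidual n f g₁ g₂ θ Q x y z ≤ C * ‖a‖ + 2 * ‖b‖ + 2 * ‖c‖ := by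
  obtain ⟨-, ha, hb, hc⟩ := h
  rw [kktResidual, grad_lagrangian hf hg₁ hg₂, ← ha]
  gcongr
  · exact hC a
  · exact norm_sub_le_two_mul_of_monotone (y' := g₁ x + y - prox θ (g₁ x + y)) (by abel)
      (subdifferential_monotone hθ.ne_bot (sub_prox_mem_subdifferential hθ hb _) hb)
  · exact norm_sub_le_two_mul_of_monotone (y' := g₂ x + z - proj Q (g₂ x + z)) (by abel)
      (normalCone_monotone hQ (proj_spec ⟨_, hc.1⟩ hQ_closed hQ _) hc)

/-- Every `(x, y, z)` is close to a solution of a perturbed system, the perturbation being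
controlled by the residual. -/
lemma exists_isPerturbedKKTPoint (hf : MDifferentiableAt (𝓡 n) 𝓘(ℝ, ℝ) f x)
    (hg₁ : MDifferentiableAt (𝓡 n) 𝓘(ℝ, Y) g₁ x) (hg₂ : MDifferentiableAt (𝓡 n) 𝓘(ℝ, Z) g₂ x)
    (hθ : IsProperClosedConvex θ) {u₀ y₀ : Y} (h₀ : y₀ ∈ subdifferential θ u₀)
    (hQ_ne : Q.Nonempty) (hQ_closed : IsClosed Q) (hQ : Convex ℝ Q) (hx : x ∈ φ.source)
    {C C₁ C₂ : ℝ} (hC0 : 0 ≤ C)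
    (hC : ∀ η : TangentSpace (𝓡 n) x, ∃ a : EuclideanSpace ℝ (Fin n),
      chartDerivInv φ x (WithLp.toLp 2 ((metricMatrix φ x)⁻¹ *ᵥ a.ofLp)) = η ∧ ‖a‖ ≤ C * ‖η‖)
    (hC₁ : ‖differential n g₁ x‖ ≤ C₁) (hC₂ : ‖differential n g₂ x‖ ≤ C₂) (y : Y) (z : Z) :
    ∃ (a : EuclideanSpace ℝ (Fin n)) (b : Y) (c : Z),
      IsPerturbedKKTPoint φ f g₁ g₂ θ Q a b c x (y - b) (z - c) ∧
      ‖WithLp.toLp 2 (a, WithLp.toLp 2 (b, c))‖ ≤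
        (C * (1 + C₁ + C₂) + 1) * kktResidual n f g₁ g₂ θ Q x y z ∧
      ‖WithLp.toLp 2 (b, c)‖ ≤ kktResidual n f g₁ g₂ θ Q x y z := by
  set b : Y := prox θ (g₁ x + y) - g₁ x with hb
  set c : Z := proj Q (g₂ x + z) - g₂ x with hc
  have hyb : y - b = g₁ x + y - prox θ (g₁ x + y) := by rw [hb]; abel
  have hzc : z - c = g₂ x + z - proj Q (g₂ x + z) := by rw [hc]; abel
  set R := kktResidual n f g₁ g₂ θ Q x y z with hR
  set ξ := grad n (fun x' => lagrangian f g₁ g₂ x' y z) x with hξ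
  have hR' : R = ‖ξ‖ + ‖b‖ + ‖c‖ := by
    rw [hR, kktResidual, hb, hc, norm_sub_rev (g₁ x), norm_sub_rev (g₂ x)]
  -- The stationarity error at the shifted multipliers `(y - b, z - c)`.
  set η := ξ - differentialAdjoint n g₁ x b - differentialAdjoint n g₂ x c with hη
  have hadj₁ : ‖differentialAdjoint n g₁ x b‖ ≤ C₁ * ‖b‖ := by
    refine (ContinuousLinearMap.le_opNorm _ _).trans ?_
    rw [differentialAdjoint, LinearIsometryEquiv.norm_map]
    gcongr
  have hadj₂ : ‖differentialAdjoint n g₂ x c‖ ≤ C₂ * ‖c‖ := by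
    refine (ContinuousLinearMap.le_opNorm _ _).trans ?_
    rw [differentialAdjoint, LinearIsometryEquiv.norm_map]
    gcongr
  have hC₁0 : 0 ≤ C₁ := (norm_nonneg (differential n g₁ x)).trans hC₁
  have hC₂0 : 0 ≤ C₂ := (norm_nonneg (differential n g₂ x)).trans hC₂
  have hηR : ‖η‖ ≤ (1 + C₁ + C₂) * R := by
    have h1 : ‖η‖ ≤ ‖ξ‖ + ‖differentialAdjoint n g₁ x b‖ + ‖differentialAdjoint n g₂ x c‖ :=
      (norm_sub_le _ _).trans (by gcongr; exact norm_sub_le _ _)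
    have h2 : C₁ * ‖b‖ ≤ C₁ * R := by
      gcongr; rw [hR']; linarith [norm_nonneg ξ, norm_nonneg c]
    have h3 : C₂ * ‖c‖ ≤ C₂ * R := by
      gcongr; rw [hR']; linarith [norm_nonneg ξ, norm_nonneg b]
    have h4 : ‖ξ‖ ≤ R := by rw [hR']; linarith [norm_nonneg b, norm_nonneg c]
    linarith
  obtain ⟨a, ha, haη⟩ := hC η
  have hbc : ‖WithLp.toLp 2 (b, c)‖ ≤ R :=
    (norm_toLp_prod_le b c).trans (by rw [hR']; linarith [norm_nonneg ξ])
  refine ⟨a, b, c, ⟨hx, ?_, ?_, ?_⟩, ?_, hbc⟩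
  · rw [ha, hη, hξ, grad_lagrangian hf hg₁ hg₂, map_sub _ y b, map_sub _ z c]
    abel
  · rw [hyb, hb, add_sub_cancel]
    exact sub_prox_mem_subdifferential hθ h₀ _
  · rw [hzc, hc, add_sub_cancel]
    exact proj_spec hQ_ne hQ_closed hQ _
  · have h1 : ‖a‖ ≤ C * ((1 + C₁ + C₂) * R) := haη.trans (by gcongr)
    linarith [norm_toLp_prod_le a (WithLp.toLp 2 (b, c))]

end Residual

end ManifoldKKT

/-! ### The equivalence. -/

theorem mainTheorem7 {n : ℕ}
    {M : Type*} [TopologicalSpace M] [ChartedSpace (EuclideanSpace ℝ (Fin n)) M]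
    [IsManifold (𝓡 n) ∞ M]
    [RiemannianBundle (fun x : M => TangentSpace (𝓡 n) x)]
    [IsContMDiffRiemannianBundle (𝓡 n) ∞ (EuclideanSpace ℝ (Fin n))
      (fun x : M => TangentSpace (𝓡 n) x)]
    {Y : Type*} [NormedAddCommGroup Y] [InnerProductSpace ℝ Y] [FiniteDimensional ℝ Y]
    {Z : Type*} [NormedAddCommGroup Z] [InnerProductSpace ℝ Z] [FiniteDimensional ℝ Z]
    (f : M → ℝ) (hf : ContMDiff (𝓡 n) 𝓘(ℝ, ℝ) 2 f)
    (g₁ : M → Y) (hg₁ : ContMDiff (𝓡 n) 𝓘(ℝ, Y) 2 g₁)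
    (g₂ : M → Z) (hg₂ : ContMDiff (𝓡 n) 𝓘(ℝ, Z) 2 g₂)
    (θ : Y → EReal) (hθ : ManifoldKKT.IsProperClosedConvex θ)
    (Q : Set Z) (hQ_ne : Q.Nonempty) (hQ_closed : IsClosed Q) (hQ_convex : Convex ℝ Q)
    (xs : M) (ys : Y) (zs : Z)
    (hKKT : ManifoldKKT.IsKKTPoint n f g₁ g₂ θ Q xs ys zs)
    (φ : OpenPartialHomeomorph M (EuclideanSpace ℝ (Fin n)))
    (hφ : φ ∈ IsManifold.maximalAtlas (𝓡 n) ∞ M) (hxs : xs ∈ φ.source) :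
    (∃ U ∈ 𝓝 xs, ∃ κ : ℝ, 0 < κ ∧ ∃ δ : ℝ, 0 < δ ∧
      ∀ (a : EuclideanSpace ℝ (Fin n)) (b : Y) (c : Z),
        ‖WithLp.toLp 2 (a, WithLp.toLp 2 (b, c))‖ < δ →
        ∀ x ∈ U, ∀ (y : Y) (z : Z),
          ManifoldKKT.IsPerturbedKKTPoint φ f g₁ g₂ θ Q a b c x y z →
          riemannianEDist (𝓡 n) x xs +
              Metric.infEDist (WithLp.toLp 2 (y, z))
                (ManifoldKKT.multipliers φ f g₁ g₂ θ Q xs 0 0 0) ≤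
            ENNReal.ofReal (κ * ‖WithLp.toLp 2 (a, WithLp.toLp 2 (b, c))‖)) ↔
    (∃ U ∈ 𝓝 xs, ∃ κ : ℝ, 0 < κ ∧ ∃ ε : ℝ, 0 < ε ∧
      ∀ x ∈ U, ∀ (y : Y) (z : Z),
        ManifoldKKT.kktResidual n f g₁ g₂ θ Q x y z < ε →
        riemannianEDist (𝓡 n) x xs +
            Metric.infEDist (WithLp.toLp 2 (y, z))
              (ManifoldKKT.multipliers φ f g₁ g₂ θ Q xs 0 0 0) ≤
          ENNReal.ofReal (κ * ManifoldKKT.kktResidual n f g₁ g₂ θ Q x y z)) := by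
  have : IsManifold (𝓡 n) 1 M := IsManifold.of_le (n := ∞) (by simp)
  have : IsContinuousRiemannianBundle (EuclideanSpace ℝ (Fin n))
      (fun x : M => TangentSpace (𝓡 n) x) := by
    obtain ⟨g, hg, h⟩ := IsContMDiffRiemannianBundle.exists_contMDiff (IB := 𝓡 n) (n := ∞)
      (F := EuclideanSpace ℝ (Fin n)) (E := fun x : M => TangentSpace (𝓡 n) x)
    exact ⟨g, hg.continuous, h⟩
  have hφ1 : φ ∈ IsManifold.maximalAtlas (𝓡 n) 1 M :=
    IsManifold.maximalAtlas_subset_of_le (by simp) hφ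
  have hfd (x : M) := (hf x).mdifferentiableAt (by simp)
  have hg₁d (x : M) := (hg₁ x).mdifferentiableAt (by simp)
  have hg₂d (x : M) := (hg₂ x).mdifferentiableAt (by simp)
  obtain ⟨C, hC0, hC⟩ := ManifoldKKT.exists_bound_chartDerivInv_metricMatrix_inv hφ1 hxs
  constructor
  · rintro ⟨U, hU, κ, hκ, δ, hδ, h⟩
    obtain ⟨C₁, hC₁0, hC₁⟩ :=
      ManifoldKKT.exists_norm_differential_le ((hg₁ xs).of_le one_le_two)
    obtain ⟨C₂, hC₂0, hC₂⟩ :=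
      ManifoldKKT.exists_norm_differential_le ((hg₂ xs).of_le one_le_two)
    set K := C * (1 + C₁ + C₂) + 1 with hK
    have hK0 : 0 < K := by positivity
    -- `K` bounds the perturbation by the residual, hence `δ / K`; the extra `1` pays for the shift
    -- of the multipliers by `(b, c)`.
    refine ⟨_, inter_mem hU (inter_mem hC (inter_mem hC₁ (inter_mem hC₂
      (φ.open_source.mem_nhds hxs)))), κ * K + 1, by positivity, δ / K, by positivity, ?_⟩
    rintro x ⟨hxU, hxC, hxC₁, hxC₂, hxφ⟩ y z hR
    obtain ⟨a, b, c, hq, hqR, hbc⟩ := ManifoldKKT.exists_isPerturbedKKTPoint (hfd x) (hg₁d x)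
      (hg₂d x) hθ hKKT.2.1 hQ_ne hQ_closed hQ_convex hxφ hC0.le hxC.2 hxC₁ hxC₂ y z
    set R := ManifoldKKT.kktResidual n f g₁ g₂ θ Q x y z
    have hR0 : 0 ≤ R := (norm_nonneg _).trans hbc
    have h1 := h a b c (hqR.trans_lt (by rwa [lt_div_iff₀' hK0] at hR)) x hxU _ _ hq
    have h2 : edist (WithLp.toLp 2 (y, z)) (WithLp.toLp 2 (y - b, z - c)) ≤ ENNReal.ofReal R := by
      have : WithLp.toLp 2 (y, z) - WithLp.toLp 2 (y - b, z - c) = WithLp.toLp 2 (b, c) := by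
        rw [← WithLp.toLp_sub]; simp
      rw [edist_dist, dist_eq_norm, this]
      exact ENNReal.ofReal_le_ofReal hbc
    calc _ ≤ riemannianEDist (𝓡 n) x xs +
          (Metric.infEDist (WithLp.toLp 2 (y - b, z - c))
            (ManifoldKKT.multipliers φ f g₁ g₂ θ Q xs 0 0 0) + ENNReal.ofReal R) := by
          gcongr
          exact Metric.infEDist_le_infEDist_add_edist.trans (by gcongr)
      _ ≤ ENNReal.ofReal (κ * (K * R)) + ENNReal.ofReal R := by
          rw [← add_assoc]
          gcongr
          exact h1.trans (ENNReal.ofReal_le_ofReal (by gcongr))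
      _ = ENNReal.ofReal ((κ * K + 1) * R) := by
          rw [← ENNReal.ofReal_add (by positivity) hR0]
          congr 1; ring
  · rintro ⟨U, hU, κ, hκ, ε, hε, h⟩
    -- `C + 4` collects `C‖a‖ + 2‖b‖ + 2‖c‖`, each component being at most `‖q‖`.
    have hK0 : 0 < C + 4 := by positivity
    refine ⟨_, inter_mem hU hC, κ * (C + 4), by positivity, ε / (C + 4), by positivity, ?_⟩
    rintro a b c hq x ⟨hxU, hxC⟩ y z hsol
    have hR := hsol.kktResidual_le (hfd x) (hg₁d x) (hg₂d x) hθ hQ_closed hQ_convex hxC.1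
    set q := WithLp.toLp 2 (a, WithLp.toLp 2 (b, c)) with hq_def
    have ha : ‖a‖ ≤ ‖q‖ := WithLp.norm_fst_le _ q
    have hbc : ‖WithLp.toLp 2 (b, c)‖ ≤ ‖q‖ := WithLp.norm_snd_le _ q
    have hb : ‖b‖ ≤ ‖q‖ := (WithLp.norm_fst_le _ (WithLp.toLp 2 (b, c))).trans hbc
    have hc : ‖c‖ ≤ ‖q‖ := (WithLp.norm_snd_le _ (WithLp.toLp 2 (b, c))).trans hbc
    have hRq : ManifoldKKT.kktResidual n f g₁ g₂ θ Q x y z ≤ (C + 4) * ‖q‖ := by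
      have : C * ‖a‖ ≤ C * ‖q‖ := by gcongr
      linarith
    refine (h x hxU y z (hRq.trans_lt (by rwa [lt_div_iff₀' hK0] at hq))).trans ?_
    rw [mul_assoc]
    exact ENNReal.ofReal_le_ofReal (by gcongr)
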